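/- Let $\omega_1,\omega_2\in\mathbb{C}$ be linearly independent over $\mathbb{R}$, let $L=\mathbb{Z}\omega_1\oplus\mathbb{Z}\omega_2$ be the lattice they generate, and let $\mathbb{C}/L$ be the quotient of abelian groups. Put $$G_k(L)=\sum_{\omega\in L\setminus\{0\}}\omega^{-k}\quad(k\ge 3),\qquad \wp(z)=\frac1{z^2}+\sum_{\omega\in L\setminus\{0\}}\left(\frac1{(z-\omega)^2}-\frac1{\omega^2}\right)\quad(z\in\mathbb{C}\setminus L),$$ so that $\wp'(z)=-2\sum_{\omega\in L}(z-\omega)^{-3}$. **Theorem.** The equation $$y^2=4x^3-60\,G_4(L)\,x-140\,G_6(L)$$ defines an elliptic curve $E_{\mathbb{C}}$ over $\mathbb{C}$; that is, its projective closure is non-singular, and the cubic on the right-hand side has non-zero discriminant (three distinct roots). Let $E_{\mathbb{C}}$ also denote the abelian group formed by the complex solutions $(x,y)$ of this equation together with the point at infinity $O$, under chord-and-tangent addition with zero element $O$. Then there is an isomorphism of abelian groups $\mathbb{C}/L\to E_{\mathbb{C}}$ given by $$z+L\mapsto(\wp(z),\wp'(z))\quad\text{for } z\notin L,\qquad 0\mapsto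 O.$$ In particular, $(\wp(z),\wp'(z))$ satisfies the equation for every $z\notin L$. -/

import Mathlib

/-- The homogeneous cubic form `Y²Z - 4X³ + aXZ² + bZ³` in the variables `X = X₀`, `Y = X₁`,
`Z = X₂`. Its zero locus in the projective plane is the projective closure of the affine curve
`y² = 4x³ - ax - b`. -/
noncomputable def cubicForm (a b : ℂ) : MvPolynomial (Fin 3) ℂ :=
  MvPolynomial.X 1 ^ 2 * MvPolynomial.X 2 - MvPolynomial.C 4 * MvPolynomial.X 0 ^ 3
    + MvPolynomial.C a * MvPolynomial.X 0 * MvPolynomial.X 2 ^ 2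
    + MvPolynomial.C b * MvPolynomial.X 2 ^ 3

/-- The projective plane curve `Y²Z = 4X³ - aXZ² - bZ³` is non-singular: at every point of it,
some partial derivative of the defining form does not vanish. -/
def IsNonsingularCubic (a b : ℂ) : Prop :=
  ∀ v : Fin 3 → ℂ, v ≠ 0 → MvPolynomial.eval v (cubicForm a b) = 0 →
    ∃ i : Fin 3, MvPolynomial.eval v (MvPolynomial.pderiv i (cubicForm a b)) ≠ 0

/-- An elliptic curve over `ℂ` given by a non-singular equation `y² = 4x³ - ax - b`. -/
structure EllipticCubic where
  /-- The coefficient `a` in `y² = 4x³ - ax - b`. -/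
  a : ℂ
  /-- The coefficient `b` in `y² = 4x³ - ax - b`. -/
  b : ℂ
  nonsingular : IsNonsingularCubic a b

namespace EllipticCubic

/-- The complex points of the elliptic curve `y² = 4x³ - ax - b`: the point at infinity `O` and
the affine solutions `(x, y)` of the equation. -/
inductive Point (E : EllipticCubic) : Type
  | O : Point E
  | affine (x y : ℂ) (h : y ^ 2 = 4 * x ^ 3 - E.a * x - E.b) : Point E

variable {E : EllipticCubic}

/-- The slope of the line through the points `(x₁, y₁)` and `(x₂, y₂)`, which is the tangent line
at `(x₁, y₁)` if the points coincide. It is used only if the line is not vertical. -/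
noncomputable def slope (E : EllipticCubic) (x₁ y₁ x₂ y₂ : ℂ) : ℂ :=
  open Classical in
  if x₁ = x₂ then (12 * x₁ ^ 2 - E.a) / (2 * y₁) else (y₁ - y₂) / (x₁ - x₂)

/-- If the line through two affine points is not vertical, then its third point of intersection
with the curve, reflected in the `x`-axis, is again a point of the curve. -/
theorem equation_add {x₁ y₁ x₂ y₂ : ℂ}
    (h₁ : y₁ ^ 2 = 4 * x₁ ^ 3 - E.a * x₁ - E.b) (h₂ : y₂ ^ 2 = 4 * x₂ ^ 3 - E.a * x₂ - E.b)
    (h : ¬ (x₁ = x₂ ∧ y₁ = -y₂)) :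
    (-(y₁ + E.slope x₁ y₁ x₂ y₂ * ((E.slope x₁ y₁ x₂ y₂ ^ 2 / 4 - x₁ - x₂) - x₁))) ^ 2 =
      4 * (E.slope x₁ y₁ x₂ y₂ ^ 2 / 4 - x₁ - x₂) ^ 3
        - E.a * (E.slope x₁ y₁ x₂ y₂ ^ 2 / 4 - x₁ - x₂) - E.b := by
  by_cases hx : x₁ = x₂
  · subst hx
    have hne : y₁ ≠ -y₂ := fun hy => h ⟨rfl, hy⟩
    have hy : y₁ = y₂ := by
      have : (y₁ - y₂) * (y₁ + y₂) = 0 := by linear_combination h₁ - h₂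
      rcases mul_eq_zero.mp this with h' | h'
      · exact sub_eq_zero.mp h'
      · exact absurd (eq_neg_of_add_eq_zero_left h') hne
    subst hy
    have hy0 : y₁ ≠ 0 := by
      rintro rfl
      exact hne (by simp)
    have hm : E.slope x₁ y₁ x₁ y₁ * (2 * y₁) = 12 * x₁ ^ 2 - E.a := by
      simp only [slope, if_true]
      field_simp
    generalize E.slope x₁ y₁ x₁ y₁ = m at hm
    linear_combination h₁ + (m ^ 2 / 4 - 3 * x₁) * hm
  · have hd : x₁ - x₂ ≠ 0 := sub_ne_zero.mpr hx
    have hm : E.slope x₁ y₁ x₂ y₂ * (x₁ - x₂) = y₁ - y₂ := by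
      simp only [slope, if_neg hx]
      field_simp
    generalize E.slope x₁ y₁ x₂ y₂ = m at hm
    apply mul_left_cancel₀ hd
    have hy : y₂ = y₁ - m * (x₁ - x₂) := by linear_combination hm
    subst hy
    linear_combination (x₁ - x₂) * h₁ + (m ^ 2 / 4 - 2 * x₁ - x₂) * (h₁ - h₂)

/-- The chord and tangent addition: `O` is neutral, two points on a vertical line (or a point
with a vertical tangent line, added to itself) have sum `O`, and in all other cases the sum is the
reflection in the `x`-axis of the third point of intersection of the line with the curve. -/
noncomputable def add : Point E → Point E → Point E
  | .O, Q => Q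
  | P, .O => P
  | .affine x₁ y₁ h₁, .affine x₂ y₂ h₂ =>
    open Classical in
    if h : x₁ = x₂ ∧ y₁ = -y₂ then .O
    else .affine (E.slope x₁ y₁ x₂ y₂ ^ 2 / 4 - x₁ - x₂)
      (-(y₁ + E.slope x₁ y₁ x₂ y₂ * ((E.slope x₁ y₁ x₂ y₂ ^ 2 / 4 - x₁ - x₂) - x₁)))
      (equation_add h₁ h₂ h)

/-- Reflection in the `x`-axis, with `O` fixed. -/
def neg : Point E → Point E
  | .O => .O
  | .affine x y h => .affine x (-y) (by rw [neg_sq, h])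

noncomputable instance : Zero (Point E) := ⟨.O⟩
noncomputable instance : Add (Point E) := ⟨add⟩
noncomputable instance : Neg (Point E) := ⟨neg⟩

/-- The monic model `Y² = x³ - (a/4)x - b/4`, with `Y = y/2`. It serves only to obtain the group
axioms for the chord and tangent addition. -/
noncomputable def monic (E : EllipticCubic) : WeierstrassCurve.Affine ℂ :=
  ⟨0, 0, 0, -E.a / 4, -E.b / 4⟩

theorem monic_nonsingular {x y : ℂ} (h : y ^ 2 = 4 * x ^ 3 - E.a * x - E.b) :
    E.monic.Nonsingular x (y / 2) := by
  rw [WeierstrassCurve.Affine.nonsingular_iff', WeierstrassCurve.Affine.equation_iff]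
  refine ⟨by simp only [monic]; linear_combination h / 4, ?_⟩
  by_contra hc
  simp only [monic, not_or, not_not] at hc
  obtain ⟨hcx, hcy⟩ := hc
  have hy : y = 0 := by linear_combination hcy
  subst hy
  have hx : 12 * x ^ 2 - E.a = 0 := by linear_combination -4 * hcx
  have hv : (![x, 0, 1] : Fin 3 → ℂ) ≠ 0 := by
    intro h0
    simpa using congrFun h0 2
  obtain ⟨i, hi⟩ := E.nonsingular ![x, 0, 1] hv (by
    simp only [cubicForm, map_add, map_sub, map_mul, map_pow, MvPolynomial.eval_X,
      MvPolynomial.eval_C]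
    simp
    linear_combination h)
  apply hi
  fin_cases i <;>
    simp [cubicForm, MvPolynomial.pderiv_X]
  · linear_combination -hx
  · linear_combination 3 * h + x * hx

/-- The map `(x, y) ↦ (x, y/2)` to the monic model. -/
noncomputable def toMonic : Point E → E.monic.Point
  | .O => 0
  | .affine x y h => .some x (y / 2) (monic_nonsingular h)

theorem toMonic_injective : Function.Injective (toMonic (E := E)) := by
  rintro (_ | ⟨x₁, y₁, h₁⟩) (_ | ⟨x₂, y₂, h₂⟩) h
  · rfl
  · cases h
  · cases h
  · simp only [toMonic, WeierstrassCurve.Affine.Point.some.injEq] at h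
    obtain ⟨rfl, h⟩ := h
    have : y₁ = y₂ := by linear_combination 2 * h
    subst this
    rfl

theorem toMonic_add (P Q : Point E) : toMonic (P + Q) = toMonic P + toMonic Q := by
  rcases P with _ | ⟨x₁, y₁, h₁⟩
  · exact (zero_add (toMonic Q)).symm
  rcases Q with _ | ⟨x₂, y₂, h₂⟩
  · exact (add_zero (toMonic (.affine x₁ y₁ h₁))).symm
  change toMonic (add _ _) = _
  by_cases h : x₁ = x₂ ∧ y₁ = -y₂
  · simp only [add, dif_pos h, toMonic]
    rw [WeierstrassCurve.Affine.Point.add_of_Y_eq h.1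
      (by simp only [WeierstrassCurve.Affine.negY, monic]; rw [h.2]; ring)]
  · have h' : ¬ (x₁ = x₂ ∧ y₁ / 2 = E.monic.negY x₂ (y₂ / 2)) := by
      rintro ⟨hx, hy⟩
      simp only [WeierstrassCurve.Affine.negY, monic] at hy
      exact h ⟨hx, by linear_combination 2 * hy⟩
    have hs : E.monic.slope x₁ x₂ (y₁ / 2) (y₂ / 2) = E.slope x₁ y₁ x₂ y₂ / 2 := by
      by_cases hx : x₁ = x₂
      · have hy : y₁ / 2 ≠ E.monic.negY x₂ (y₂ / 2) := fun hy => h' ⟨hx, hy⟩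
        rw [WeierstrassCurve.Affine.slope_of_Y_ne hx hy]
        have hy0 : y₁ ≠ 0 := by
          rintro rfl
          subst hx
          refine h ⟨rfl, ?_⟩
          have : y₂ ^ 2 = 0 := by linear_combination h₂ - h₁
          rw [pow_eq_zero_iff two_ne_zero] at this
          simp [this]
        simp only [slope, if_pos hx, WeierstrassCurve.Affine.negY, monic]
        have hd : y₁ / 2 - (-(y₁ / 2) - 0 * x₁ - 0) = y₁ := by ring
        rw [hd]
        field_simp
        ring
      · rw [WeierstrassCurve.Affine.slope_of_X_ne hx]
        simp only [slope, if_neg hx]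
        ring
    simp only [add, dif_neg h, toMonic]
    rw [WeierstrassCurve.Affine.Point.add_some h', WeierstrassCurve.Affine.Point.some.injEq]
    simp only [WeierstrassCurve.Affine.addX, WeierstrassCurve.Affine.addY,
      WeierstrassCurve.Affine.negAddY, WeierstrassCurve.Affine.negY, hs]
    simp only [monic]
    constructor <;> ring

theorem toMonic_neg (P : Point E) : toMonic (-P) = -toMonic P := by
  rcases P with _ | ⟨x, y, h⟩
  · rfl
  · change toMonic (neg _) = _
    simp only [neg, toMonic, WeierstrassCurve.Affine.Point.neg_some,
      WeierstrassCurve.Affine.Point.some.injEq, true_and]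
    simp only [WeierstrassCurve.Affine.negY, monic]
    ring

/-- The points of an elliptic curve form an abelian group under the chord and tangent addition,
with zero element `O` and reflection in the `x`-axis as negation. -/
noncomputable instance : AddCommGroup (Point E) where
  add_assoc P Q R := toMonic_injective (by simp only [toMonic_add, add_assoc])
  zero_add P := toMonic_injective (by rw [toMonic_add]; exact zero_add _)
  add_zero P := toMonic_injective (by rw [toMonic_add]; exact add_zero _)
  neg_add_cancel P := toMonic_injective (by
    rw [toMonic_add, toMonic_neg, neg_add_cancel]; rfl)
  add_comm P Q := toMonic_injective (by simp only [toMonic_add, add_comm])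
  nsmul := nsmulRec
  zsmul := zsmulRec

end EllipticCubic

/-! Everything rests on the second-order equation `℘'' = 6℘² - g₂/2`, obtained by differentiating
the cubic relation, and on uniqueness of its analytic solutions. Liouville's theorem makes `℘`
surjective (`exists_weierstrassP_eq`). If the cubic had a double root `e`, the constant `e` would
solve the equation with the same initial values as `℘` at a point where `℘ = e`, so `℘` would be
constant (`g₂_cube_ne`). If `(℘, ℘')` agrees at `z` and `w`, then `℘` equals its translate by `w -
z`, and the pole at `0` forces `w - z ∈ L`. For the addition theorem (`weierstrassP_add`), adding a
fixed point of the curve preserves the vector field `x' = y`, `y' = 6x² - g₂/2`. Hence the first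
coordinate of the sum of the points at `v` and `w`, as a function of `v`, solves the same equation
and is `℘(v + d)` for some constant `d`; letting `v → 0` gives `d ≡ w` mod `L`. Duplication follows
from this generic case and associativity, without tangent lines. -/

open Filter Topology

/-! ### Uniqueness for the differential equation of `℘` -/

/-- An analytic solution of `h'' = q h` whose value and derivative vanish at a point vanishes
near that point. -/
theorem eventually_eq_zero_of_deriv_deriv_eq_mul {h q : ℂ → ℂ} {c : ℂ}
    (hh : AnalyticAt ℂ h c) (hq : AnalyticAt ℂ q c) (h0 : h c = 0) (h1 : deriv h c = 0)
    (heq : ∀ᶠ z in 𝓝 c, deriv (deriv h) z = q z * h z) : ∀ᶠ z in 𝓝 c, h z = 0 := by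
  rw [← analyticOrderAt_eq_top, ENat.eq_top_iff_forall_ge]
  intro n
  -- If `h` vanishes to order `n`, so does `h'' = q h`; with `h c = h' c = 0` this kills all
  -- derivatives of order at most `n`.
  induction n with
  | zero => simp
  | succ n ih =>
    refine (natCast_le_analyticOrderAt_iff_iteratedDeriv_eq_zero hh).mpr fun i hi => ?_
    match i with
    | 0 => simpa using h0
    | 1 => simpa using h1
    | i + 2 =>
      have key : (n : ℕ∞) ≤ analyticOrderAt (fun z => q z * h z) c := by
        change _ ≤ analyticOrderAt (q * h) c
        rw [analyticOrderAt_mul hq hh]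
        exact ih.trans le_add_self
      have := (natCast_le_analyticOrderAt_iff_iteratedDeriv_eq_zero (hq.mul hh)).mp key i (by omega)
      rw [iteratedDeriv_succ', iteratedDeriv_succ', Filter.EventuallyEq.iteratedDeriv_eq i heq]
      exact this

/-- Uniqueness of the analytic solutions of `f'' = 6 f² - p / 2` with given initial values. -/
theorem eventuallyEq_of_deriv_deriv_eq {f g : ℂ → ℂ} {c p : ℂ}
    (hf : AnalyticAt ℂ f c) (hg : AnalyticAt ℂ g c) (h0 : f c = g c) (h1 : deriv f c = deriv g c)
    (hf2 : ∀ᶠ z in 𝓝 c, deriv (deriv f) z = 6 * f z ^ 2 - p / 2)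
    (hg2 : ∀ᶠ z in 𝓝 c, deriv (deriv g) z = 6 * g z ^ 2 - p / 2) : f =ᶠ[𝓝 c] g := by
  have hd : ∀ᶠ z in 𝓝 c, deriv (fun w => f w - g w) z = deriv f z - deriv g z := by
    filter_upwards [hf.eventually_analyticAt, hg.eventually_analyticAt] with z hz hz'
    exact deriv_fun_sub hz.differentiableAt hz'.differentiableAt
  -- The difference satisfies a linear equation because `f² - g² = (f + g)(f - g)`.
  have := eventually_eq_zero_of_deriv_deriv_eq_mul (h := fun z => f z - g z)
    (q := fun z => 6 * (f z + g z)) (hf.sub hg) (by fun_prop) (by simp [h0])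
    (by rw [hd.self_of_nhds, h1, sub_self]) (by
      filter_upwards [hd.eventually_nhds, hf.deriv.eventually_analyticAt,
        hg.deriv.eventually_analyticAt, hf2, hg2] with z hz h1 h2 h3 h4
      have hz' : deriv (fun w => f w - g w) =ᶠ[𝓝 z] fun w => deriv f w - deriv g w := hz
      rw [hz'.deriv_eq, deriv_fun_sub h1.differentiableAt h2.differentiableAt, h3, h4]
      ring)
  filter_upwards [this] with z hz using sub_eq_zero.mp hz

/-! ### Adding a fixed point of the cubic by chords -/

/-- The first coordinate of the sum of the points `(x, y)` and `(a, b)` with `x ≠ a` on a curve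
`y² = 4x³ - px - q`. -/
noncomputable def chordX (a b x y : ℂ) : ℂ := ((y - b) / (x - a)) ^ 2 / 4 - x - a

/-- The second coordinate of the sum of the points `(x, y)` and `(a, b)` with `x ≠ a` on a curve
`y² = 4x³ - px - q`. -/
noncomputable def chordY (a b x y : ℂ) : ℂ :=
  -(y + (y - b) / (x - a) * (chordX a b x y - x))

/-- Subtract the two curve equations and divide by `x - a`. This eliminates `p`, turning later
claims into rational identities. -/
theorem chord_relation {a b x y p q : ℂ} (h : y ^ 2 = 4 * x ^ 3 - p * x - q)
    (hab : b ^ 2 = 4 * a ^ 3 - p * a - q) (hne : x ≠ a) :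
    p = 4 * (x ^ 2 + a * x + a ^ 2) - (y + b) * ((y - b) / (x - a)) := by
  have hD : x - a ≠ 0 := sub_ne_zero.mpr hne
  field_simp
  linear_combination h - hab

/-- Translation by a fixed point preserves the vector field `x' = y`, `y' = 6x² - p / 2`. -/
theorem hasDerivAt_chord {x y : ℂ → ℂ} {z a b p q : ℂ} (hx : HasDerivAt x (y z) z)
    (hy : HasDerivAt y (6 * x z ^ 2 - p / 2) z) (h : y z ^ 2 = 4 * x z ^ 3 - p * x z - q)
    (hab : b ^ 2 = 4 * a ^ 3 - p * a - q) (hne : x z ≠ a) :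
    HasDerivAt (fun w => chordX a b (x w) (y w)) (chordY a b (x z) (y z)) z ∧
    HasDerivAt (fun w => chordY a b (x w) (y w)) (6 * chordX a b (x z) (y z) ^ 2 - p / 2) z := by
  have hD : x z - a ≠ 0 := sub_ne_zero.mpr hne
  have hp := chord_relation h hab hne
  have hm := (hy.sub_const b).fun_div (hx.sub_const a) hD
  -- In the coordinates `x = a + D`, `y = b + mD`, with `m` the slope, only powers of `D` remain in
  -- denominators.
  obtain ⟨D, hxD⟩ : ∃ D, x z = a + D := ⟨x z - a, by ring⟩
  rw [hxD, add_sub_cancel_left] at hD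
  obtain ⟨m, hym⟩ : ∃ m, y z = b + m * D := ⟨(y z - b) / D, by field_simp; ring⟩
  rw [hxD, hym, add_sub_cancel_left, add_sub_cancel_left, mul_div_cancel_right₀ _ hD] at hp
  have hX : HasDerivAt (fun w => chordX a b (x w) (y w)) (chordY a b (x z) (y z)) z := by
    refine (((hm.fun_pow 2).div_const 4).fun_sub hx).sub_const a |>.congr_deriv ?_
    rw [chordY, chordX, hxD, hym, add_sub_cancel_left, add_sub_cancel_left,
      mul_div_cancel_right₀ _ hD, hp]
    field_simp
    ring
  refine ⟨hX, (hy.fun_add (hm.fun_mul (hX.fun_sub hx))).fun_neg.congr_deriv ?_⟩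
  rw [chordY, chordX, hxD, hym, add_sub_cancel_left, add_sub_cancel_left,
    mul_div_cancel_right₀ _ hD, hp]
  field_simp
  ring

theorem chord_equation {a b x y p q : ℂ} (h : y ^ 2 = 4 * x ^ 3 - p * x - q)
    (hab : b ^ 2 = 4 * a ^ 3 - p * a - q) (hne : x ≠ a) :
    chordY a b x y ^ 2 = 4 * chordX a b x y ^ 3 - p * chordX a b x y - q := by
  have hD : x - a ≠ 0 := sub_ne_zero.mpr hne
  have hq : q = 4 * x ^ 3 - p * x - y ^ 2 := by linear_combination h
  rw [hq, chord_relation h hab hne, chordY, chordX]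
  field_simp
  ring

/-- If `(x, y)` tends to the point at infinity, then its sum with `(a, b)` tends to `(a, b)`. -/
theorem tendsto_chord {ι : Type*} {l : Filter ι} {x y : ι → ℂ} {a b p q : ℂ}
    (h : ∀ᶠ i in l, y i ^ 2 = 4 * x i ^ 3 - p * x i - q)
    (hx : Tendsto x l (Bornology.cobounded ℂ)) :
    Tendsto (fun i => chordX a b (x i) (y i)) l (𝓝 a) ∧
    Tendsto (fun i => chordY a b (x i) (y i)) l (𝓝 b) := by
  have hu : Tendsto (fun i => (x i)⁻¹) l (𝓝 0) := tendsto_inv₀_cobounded.comp hx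
  have hx0 : ∀ᶠ i in l, x i ≠ 0 := hx.eventually_ne_cobounded 0
  have hxa : ∀ᶠ i in l, x i ≠ a := hx.eventually_ne_cobounded a
  have hs : Tendsto (fun i => y i ^ 2 / x i ^ 3) l (𝓝 4) := by
    have : Tendsto (fun i => 4 - p * (x i)⁻¹ ^ 2 - q * (x i)⁻¹ ^ 3) l (𝓝 4) := by
      simpa using ((hu.pow 2).const_mul p).const_sub 4 |>.sub ((hu.pow 3).const_mul q)
    refine this.congr' ?_
    filter_upwards [h, hx0] with i hi hi0
    rw [hi]
    field_simp
  -- The square of `y / x²` is `(y² / x³) · x⁻¹`, which tends to `4 · 0`.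
  have hv : Tendsto (fun i => y i / x i ^ 2) l (𝓝 0) := by
    have hsq : Tendsto (fun i => y i ^ 2 / x i ^ 3 * (x i)⁻¹) l (𝓝 0) := by
      simpa using hs.mul hu
    rw [tendsto_zero_iff_norm_tendsto_zero] at hsq ⊢
    have := (Real.continuous_sqrt.tendsto 0).comp hsq
    rw [Real.sqrt_zero] at this
    refine this.congr' ?_
    filter_upwards [hx0] with i hi
    have : y i ^ 2 / x i ^ 3 * (x i)⁻¹ = (y i / x i ^ 2) ^ 2 := by field_simp
    simp only [Function.comp_apply]
    rw [this, norm_pow, Real.sqrt_sq (norm_nonneg _)]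
  have hd : Tendsto (fun i => 1 - a * (x i)⁻¹) l (𝓝 1) := by
    simpa using (hu.const_mul a).const_sub 1
  constructor
  -- The curve equation cancels the growing terms, leaving an expression in `x⁻¹` and `y / x²` that
  -- is regular at infinity.
  · have key : Tendsto (fun i => (a + (x i)⁻¹ * (a ^ 2 - p / 4)
        + (x i)⁻¹ ^ 2 * (b ^ 2 / 4 - a ^ 3 - q / 4) - y i / x i ^ 2 * (b / 2))
        / (1 - a * (x i)⁻¹) ^ 2) l (𝓝 a) := by
      have := ((((hu.mul_const (a ^ 2 - p / 4)).const_add a).add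
        ((hu.pow 2).mul_const (b ^ 2 / 4 - a ^ 3 - q / 4))).sub (hv.mul_const (b / 2))).div
        (hd.pow 2) (by simp)
      convert! this using 2
      simp
    refine key.congr' ?_
    filter_upwards [h, hx0, hxa] with i hi hi0 hia
    have hD : x i - a ≠ 0 := sub_ne_zero.mpr hia
    have hq : q = 4 * x i ^ 3 - p * x i - y i ^ 2 := by linear_combination hi
    rw [chordX, hq]
    field_simp
    ring
  · have key : Tendsto (fun i => -(b + ((y i / x i ^ 2 - b * (x i)⁻¹ ^ 2)
        * (3 * a ^ 2 - p / 4 + (x i)⁻¹ * (b ^ 2 / 4 - 2 * a ^ 3 - q / 4))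
        - b / 2 * (y i ^ 2 / x i ^ 3 - b * (x i)⁻¹ * (y i / x i ^ 2)))
        / (1 - a * (x i)⁻¹) ^ 3)) l (𝓝 b) := by
      have := (((((hv.sub ((hu.pow 2).const_mul b)).mul
        ((hu.mul_const (b ^ 2 / 4 - 2 * a ^ 3 - q / 4)).const_add (3 * a ^ 2 - p / 4))).sub
        ((hs.sub ((hu.const_mul b).mul hv)).const_mul (b / 2))).div
        (hd.pow 3) (by simp)).const_add b).neg
      convert! this using 2
      simp
      ring
    refine key.congr' ?_
    filter_upwards [h, hx0, hxa] with i hi hi0 hia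
    have hD : x i - a ≠ 0 := sub_ne_zero.mpr hia
    have hq : q = 4 * x i ^ 3 - p * x i - y i ^ 2 := by linear_combination hi
    rw [chordY, chordX, hq]
    field_simp
    ring

/-! ### Values and differential equation of `℘` -/

namespace PeriodPair

variable (L : PeriodPair)

theorem countable_lattice : (L.lattice : Set ℂ).Countable :=
  countable_of_Lindelof_of_discrete (X := L.lattice)

theorem compl_lattice_mem_nhds {z : ℂ} (hz : z ∉ L.lattice) : (L.lattice : Set ℂ)ᶜ ∈ 𝓝 z :=
  L.isClosed_lattice.isOpen_compl.mem_nhds hz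

theorem compl_lattice_mem_nhdsNE (z : ℂ) : (L.lattice : Set ℂ)ᶜ ∈ 𝓝[≠] z := by
  filter_upwards [self_mem_nhdsWithin,
    mem_nhdsWithin_of_mem_nhds (L.compl_lattice_sdiff_singleton_mem_nhds z)] with w hw hw'
  simp_all

theorem isPreconnected_compl_lattice : IsPreconnected (L.lattice : Set ℂ)ᶜ :=
  (L.countable_lattice.isConnected_compl_of_one_lt_rank (by simp)).isPreconnected

theorem analyticAt_weierstrassP {z : ℂ} (hz : z ∉ L.lattice) : AnalyticAt ℂ L.weierstrassP z :=
  L.analyticOnNhd_weierstrassP z hz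

theorem analyticAt_derivWeierstrassP {z : ℂ} (hz : z ∉ L.lattice) :
    AnalyticAt ℂ L.derivWeierstrassP z :=
  L.analyticOnNhd_derivWeierstrassP z hz

theorem hasDerivAt_weierstrassP {z : ℂ} (hz : z ∉ L.lattice) :
    HasDerivAt L.weierstrassP (L.derivWeierstrassP z) z := by
  rw [← L.deriv_weierstrassP]
  exact (L.analyticAt_weierstrassP hz).differentiableAt.hasDerivAt

theorem tendsto_weierstrassP_cobounded {l : ℂ} (hl : l ∈ L.lattice) :
    Tendsto L.weierstrassP (𝓝[≠] l) (Bornology.cobounded ℂ) := by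
  refine tendsto_cobounded_of_meromorphicOrderAt_neg ?_
  rw [L.order_weierstrassP l hl]
  decide

/-- Every complex number is a value of `℘`. -/
theorem exists_weierstrassP_eq (c : ℂ) : ∃ z ∉ L.lattice, L.weierstrassP z = c := by
  classical
  by_contra! hc
  -- If `c` were omitted, `1 / (℘ - c)`, set to `0` at the poles, would be entire and periodic,
  -- hence constant; but it vanishes at `0` and not at `ω₁ / 2`.
  set F : ℂ → ℂ := fun z => if z ∈ L.lattice then 0 else (L.weierstrassP z - c)⁻¹ with hF
  have hF0 {z : ℂ} (hz : z ∉ L.lattice) : DifferentiableAt ℂ F z := by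
    have : DifferentiableAt ℂ (fun z => (L.weierstrassP z - c)⁻¹) z :=
      ((L.analyticAt_weierstrassP hz).differentiableAt.sub_const c).fun_inv
        (sub_ne_zero.mpr (hc z hz))
    refine this.congr_of_eventuallyEq ?_
    filter_upwards [L.compl_lattice_mem_nhds hz] with w hw
    exact if_neg hw
  have hd : Differentiable ℂ F := by
    intro z
    by_cases hz : z ∈ L.lattice
    · refine (Complex.analyticAt_of_differentiable_on_punctured_nhds_of_continuousAt
        ?_ ?_).differentiableAt
      · filter_upwards [L.compl_lattice_mem_nhdsNE z] with w hw using hF0 hw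
      · rw [continuousAt_iff_punctured_nhds, hF]
        simp only [hz, if_true]
        have : Tendsto (fun z => (L.weierstrassP z - c)⁻¹) (𝓝[≠] z) (𝓝 0) :=
          tendsto_inv₀_cobounded.comp
            ((tendsto_sub_const_cobounded c).comp (L.tendsto_weierstrassP_cobounded hz))
        refine this.congr' ?_
        filter_upwards [L.compl_lattice_mem_nhdsNE z] with w hw
        exact (if_neg hw).symm
    · exact hF0 hz
  have hper (z w : ℂ) (hw : w ∈ L.lattice) : F (z + w) = F z := by
    lift w to L.lattice using hw
    have : z + w ∈ L.lattice ↔ z ∈ L.lattice :=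
      L.lattice.toAddSubgroup.add_mem_cancel_right w.2
    simp only [hF, this, weierstrassP_add_coe]
  have hconst := hd.apply_eq_apply_of_bounded
    (IsZLattice.isCompact_range_of_periodic L.lattice F hd.continuous hper).isBounded (L.ω₁ / 2) 0
  simp only [hF, L.ω₁_div_two_notMem_lattice, zero_mem, if_true, if_false, inv_eq_zero] at hconst
  exact hc _ L.ω₁_div_two_notMem_lattice (sub_eq_zero.mp hconst)

/-- By the identity theorem on the connected complement of `L`, `℘` would be constant there, yet it
takes the value `c + 1`. -/
theorem not_eventuallyEq_weierstrassP_const {z : ℂ} (hz : z ∉ L.lattice) (c : ℂ) :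
    ¬ ∀ᶠ w in 𝓝 z, L.weierstrassP w = c := by
  intro h
  have := L.analyticOnNhd_weierstrassP.eqOn_of_preconnected_of_eventuallyEq
    (analyticOnNhd_const (v := c)) L.isPreconnected_compl_lattice hz h
  obtain ⟨w, hw, hwc⟩ := L.exists_weierstrassP_eq (c + 1)
  have hw' := this hw
  simp [hwc] at hw'

/-- `℘'' = 6 ℘² - g₂ / 2`. -/
theorem deriv_derivWeierstrassP {z : ℂ} (hz : z ∉ L.lattice) :
    deriv L.derivWeierstrassP z = 6 * L.weierstrassP z ^ 2 - L.g₂ / 2 := by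
  have hmul : ∀ᶠ w in 𝓝 z, L.derivWeierstrassP w *
      (deriv L.derivWeierstrassP w - (6 * L.weierstrassP w ^ 2 - L.g₂ / 2)) = 0 := by
    filter_upwards [L.compl_lattice_mem_nhds hz] with w hw
    have h₁ := ((L.analyticAt_derivWeierstrassP hw).differentiableAt.hasDerivAt).fun_pow 2
    have hp := L.hasDerivAt_weierstrassP hw
    have h₂ := (((hp.fun_pow 3).const_mul 4).fun_sub (hp.const_mul L.g₂)).sub_const L.g₃
    have h₃ := h₁.congr_of_eventuallyEq (f₁ := fun z => 4 * L.weierstrassP z ^ 3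
        - L.g₂ * L.weierstrassP z - L.g₃) (by
      filter_upwards [L.compl_lattice_mem_nhds hw] with v hv
      exact (L.derivWeierstrassP_sq v hv).symm)
    have := h₂.unique h₃
    norm_num at this
    linear_combination -this / 2
  have ha := L.analyticAt_derivWeierstrassP hz
  have hb : AnalyticAt ℂ (fun w => deriv L.derivWeierstrassP w
      - (6 * L.weierstrassP w ^ 2 - L.g₂ / 2)) z := by
    have := L.analyticAt_weierstrassP hz
    have := ha.deriv
    fun_prop
  -- Zeros of a nonzero analytic germ are isolated, so one factor of the product vanishes near `z`;
  -- it cannot be `℘'`, as `℘` is not locally constant.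
  rcases hb.eventually_eq_zero_or_eventually_ne_zero with h | h
  · exact sub_eq_zero.mp h.self_of_nhds
  rcases ha.eventually_eq_zero_or_eventually_ne_zero with h' | h'
  · exfalso
    obtain ⟨ε, hε, hball⟩ := Metric.mem_nhds_iff.mp
      (inter_mem h' (L.compl_lattice_mem_nhds hz))
    refine L.not_eventuallyEq_weierstrassP_const hz (L.weierstrassP z) ?_
    filter_upwards [Metric.ball_mem_nhds z hε] with w hw
    refine Metric.isOpen_ball.is_const_of_deriv_eq_zero (convex_ball z ε).isPreconnected
      (fun v hv => (L.analyticAt_weierstrassP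
        (hball hv).2).differentiableAt.differentiableWithinAt) ?_ hw (Metric.mem_ball_self hε)
    intro v hv
    rw [deriv_weierstrassP]
    exact (hball hv).1
  · exfalso
    have : ∀ᶠ w in 𝓝[≠] z, False := by
      filter_upwards [h, h', hmul.filter_mono nhdsWithin_le_nhds] with w h₁ h₂ h₃
      exact (mul_ne_zero h₂ h₁) h₃
    exact this.exists.choose_spec

theorem hasDerivAt_derivWeierstrassP {z : ℂ} (hz : z ∉ L.lattice) :
    HasDerivAt L.derivWeierstrassP (6 * L.weierstrassP z ^ 2 - L.g₂ / 2) z := by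
  rw [← L.deriv_derivWeierstrassP hz]
  exact (L.analyticAt_derivWeierstrassP hz).differentiableAt.hasDerivAt

/-- An analytic solution of `f'' = 6 f² - g₂ / 2` is locally a translate of `℘` if it has the
same initial values. -/
theorem eventuallyEq_weierstrassP_add {f : ℂ → ℂ} {z d : ℂ} (hd : z + d ∉ L.lattice)
    (hf : AnalyticAt ℂ f z) (h0 : f z = L.weierstrassP (z + d))
    (h1 : deriv f z = L.derivWeierstrassP (z + d))
    (h2 : ∀ᶠ w in 𝓝 z, deriv (deriv f) w = 6 * f w ^ 2 - L.g₂ / 2) :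
    ∀ᶠ w in 𝓝 z, f w = L.weierstrassP (w + d) := by
  have hderiv : deriv (fun w => L.weierstrassP (w + d)) = fun w => L.derivWeierstrassP (w + d) := by
    ext w
    rw [deriv_comp_add_const, deriv_weierstrassP]
  refine eventuallyEq_of_deriv_deriv_eq hf
    ((L.analyticAt_weierstrassP hd).fun_comp (f := fun w => w + d) (by fun_prop)) h0 ?_ h2 ?_
  · rw [h1, hderiv]
  · rw [hderiv]
    have hc : ContinuousAt (fun w => w + d) z := by fun_prop
    filter_upwards [hc.preimage_mem_nhds (L.compl_lattice_mem_nhds hd)] with w hw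
    rw [deriv_comp_add_const, L.deriv_derivWeierstrassP hw]

/-- The roots of the cubic `4x³ - g₂x - g₃` are distinct. -/
theorem g₂_cube_ne : L.g₂ ^ 3 ≠ 27 * L.g₃ ^ 2 := by
  intro h
  -- Here `e` is the multiple root: `4x³ - g₂x - g₃ = 4(x - e)²(x + 2e)`.
  obtain ⟨e, he₁, he₂⟩ : ∃ e : ℂ, L.g₂ = 12 * e ^ 2 ∧ L.g₃ = -8 * e ^ 3 := by
    by_cases h0 : L.g₂ = 0
    · refine ⟨0, by simp [h0], ?_⟩
      simpa [h0] using h.symm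
    · refine ⟨-3 * L.g₃ / (2 * L.g₂), ?_, ?_⟩
      · field_simp
        linear_combination 4 * h
      · field_simp
        linear_combination 8 * L.g₃ * h
  obtain ⟨z, hz, hze⟩ := L.exists_weierstrassP_eq e
  have hz' : L.derivWeierstrassP z = 0 := by
    have := L.derivWeierstrassP_sq z hz
    rw [he₁, he₂, hze] at this
    rw [← pow_eq_zero_iff two_ne_zero, this]
    ring
  have := L.eventuallyEq_weierstrassP_add (f := fun _ => e) (z := z) (d := 0) (by simpa)
    analyticAt_const (by simp [hze]) (by simp [hz']) (by simp [he₁]; ring)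
  refine L.not_eventuallyEq_weierstrassP_const hz e ?_
  filter_upwards [this] with w hw
  simpa using hw.symm

/-! ### Fibres of `(℘, ℘')` and the addition theorem -/

/-- The points none of whose translates by the elements of `T` lies in the lattice. -/
def offLattice (T : Finset ℂ) : Set ℂ := {z | ∀ s ∈ T, z + s ∉ L.lattice}

theorem isOpen_offLattice (T : Finset ℂ) : IsOpen (L.offLattice T) := by
  have : L.offLattice T = ⋂ s ∈ T, (· + s) ⁻¹' (L.lattice : Set ℂ)ᶜ := by
    ext z
    simp [offLattice]
  rw [this]
  exact isOpen_biInter_finset fun s _ =>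
    L.isClosed_lattice.isOpen_compl.preimage (continuous_add_const s)

theorem isConnected_offLattice (T : Finset ℂ) : IsConnected (L.offLattice T) := by
  have : L.offLattice T = (⋃ s ∈ T, (· + s) ⁻¹' (L.lattice : Set ℂ))ᶜ := by
    ext z
    simp [offLattice]
  rw [this]
  exact Set.Countable.isConnected_compl_of_one_lt_rank (by simp)
    (T.countable_toSet.biUnion fun s _ => L.countable_lattice.preimage (add_left_injective s))

theorem offLattice_mem_nhdsNE (T : Finset ℂ) (z : ℂ) : L.offLattice T ∈ 𝓝[≠] z := by
  refine (eventually_all_finset T).mpr fun s _ => ?_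
  have : Tendsto (· + s) (𝓝[≠] z) (𝓝[≠] (z + s)) :=
    tendsto_nhdsWithin_of_tendsto_nhds_of_eventually_within _
      ((continuous_add_const s).continuousAt.tendsto.mono_left nhdsWithin_le_nhds)
      (by filter_upwards [self_mem_nhdsWithin] with w hw using fun h => hw (by simpa using h))
  exact this (L.compl_lattice_mem_nhdsNE (z + s))

/-- Points at which both `℘` and `℘'` agree are congruent modulo the lattice. -/
theorem sub_mem_lattice_of_weierstrassP_eq {z w : ℂ} (hz : z ∉ L.lattice) (hw : w ∉ L.lattice)
    (h0 : L.weierstrassP z = L.weierstrassP w)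
    (h1 : L.derivWeierstrassP z = L.derivWeierstrassP w) : z - w ∈ L.lattice := by
  classical
  have hloc := L.eventuallyEq_weierstrassP_add (f := L.weierstrassP) (z := z) (d := w - z)
    (by simpa) (L.analyticAt_weierstrassP hz) (by simpa) (by simpa) (by
      filter_upwards [L.compl_lattice_mem_nhds hz] with v hv
      rw [deriv_weierstrassP, L.deriv_derivWeierstrassP hv])
  by_contra hd
  have hwz : w - z ∉ L.lattice := fun h => hd (by simpa using neg_mem h)
  have hU {v : ℂ} : v ∈ L.offLattice {0, w - z} ↔ v ∉ L.lattice ∧ v + (w - z) ∉ L.lattice := by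
    simp [offLattice]
  have heq : Set.EqOn L.weierstrassP (fun v => L.weierstrassP (v + (w - z)))
      (L.offLattice {0, w - z}) := by
    refine AnalyticOnNhd.eqOn_of_preconnected_of_eventuallyEq (𝕜 := ℂ) (z₀ := z) ?_ ?_
      (L.isConnected_offLattice _).isPreconnected (hU.mpr ⟨hz, by simpa⟩) hloc
    · intro v hv
      exact L.analyticAt_weierstrassP (hU.mp hv).1
    · intro v hv
      exact (L.analyticAt_weierstrassP (hU.mp hv).2).fun_comp (f := fun v => v + (w - z))
        (by fun_prop)
  -- If `w - z ∉ L`, the translate has a finite limit at `0`, where `℘` has a pole.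
  have hlim : Tendsto (fun v => L.weierstrassP (v + (w - z))) (𝓝[≠] 0)
      (𝓝 (L.weierstrassP (w - z))) := by
    have : ContinuousAt (fun v => L.weierstrassP (v + (w - z))) 0 :=
      (L.analyticAt_weierstrassP hwz).continuousAt.comp_of_eq (f := fun v => v + (w - z))
        (by fun_prop) (by simp)
    simpa using this.tendsto.mono_left nhdsWithin_le_nhds
  exact not_tendsto_nhds_of_tendsto_atTop
    (tendsto_norm_atTop_iff_cobounded.mpr (L.tendsto_weierstrassP_cobounded (zero_mem _))) _
    (hlim.congr' (heq.symm.eventuallyEq_of_mem (L.offLattice_mem_nhdsNE _ 0))).norm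

/-- The curve equation determines `℘'` up to sign; since `℘` is even and `℘'` odd, the minus sign
replaces `w` by `-w`. -/
theorem weierstrassP_eq_iff {z w : ℂ} (hz : z ∉ L.lattice) (hw : w ∉ L.lattice) :
    L.weierstrassP z = L.weierstrassP w ↔ z - w ∈ L.lattice ∨ z + w ∈ L.lattice := by
  constructor
  · intro h
    have hsq : L.derivWeierstrassP z ^ 2 = L.derivWeierstrassP w ^ 2 := by
      rw [L.derivWeierstrassP_sq z hz, L.derivWeierstrassP_sq w hw, h]
    rcases sq_eq_sq_iff_eq_or_eq_neg.mp hsq with h' | h'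
    · exact Or.inl (L.sub_mem_lattice_of_weierstrassP_eq hz hw h h')
    · right
      have := L.sub_mem_lattice_of_weierstrassP_eq (w := -w) hz (by simpa) (by simpa) (by simpa)
      simpa using this
  · rintro (h | h)
    · simpa using (L.weierstrassP_add_coe w ⟨_, h⟩)
    · simpa using (L.weierstrassP_add_coe (-w) ⟨_, h⟩)

/-- Every point of the affine curve `y² = 4x³ - g₂x - g₃` is of the form `(℘ z, ℘' z)`. -/
theorem exists_weierstrassP_derivWeierstrassP_eq {x y : ℂ}
    (h : y ^ 2 = 4 * x ^ 3 - L.g₂ * x - L.g₃) :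
    ∃ z ∉ L.lattice, L.weierstrassP z = x ∧ L.derivWeierstrassP z = y := by
  obtain ⟨z, hz, rfl⟩ := L.exists_weierstrassP_eq x
  rw [← L.derivWeierstrassP_sq z hz] at h
  rcases sq_eq_sq_iff_eq_or_eq_neg.mp h with rfl | rfl
  · exact ⟨z, hz, rfl, rfl⟩
  · exact ⟨-z, by simpa, by simp, by simp⟩

/-- The addition theorem for `℘` and `℘'`. -/
theorem weierstrassP_add {z w : ℂ} (hz : z ∉ L.lattice) (hw : w ∉ L.lattice)
    (hne : L.weierstrassP z ≠ L.weierstrassP w) :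
    L.weierstrassP (z + w) = chordX (L.weierstrassP w) (L.derivWeierstrassP w)
      (L.weierstrassP z) (L.derivWeierstrassP z) ∧
    L.derivWeierstrassP (z + w) = chordY (L.weierstrassP w) (L.derivWeierstrassP w)
      (L.weierstrassP z) (L.derivWeierstrassP z) := by
  classical
  set X : ℂ → ℂ := fun v => chordX (L.weierstrassP w) (L.derivWeierstrassP w)
      (L.weierstrassP v) (L.derivWeierstrassP v) with hX
  set Y : ℂ → ℂ := fun v => chordY (L.weierstrassP w) (L.derivWeierstrassP w)
      (L.weierstrassP v) (L.derivWeierstrassP v) with hY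
  -- Off these translates, `v` is not a pole and the chord through the points at `v` and `w` is not
  -- vertical.
  set T : Finset ℂ := {0, -w, w}
  have hwe := L.derivWeierstrassP_sq w hw
  have hU {v : ℂ} : v ∈ L.offLattice T ↔ v ∉ L.lattice ∧ L.weierstrassP v ≠ L.weierstrassP w := by
    constructor
    · intro hv
      have h0 : v ∉ L.lattice := by simpa using hv 0 (by simp [T])
      refine ⟨h0, fun h => ?_⟩
      rcases (L.weierstrassP_eq_iff h0 hw).mp h with h | h
      · exact hv (-w) (by simp [T]) (by simpa [sub_eq_add_neg] using h)
      · exact hv w (by simp [T]) h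
    · rintro ⟨h0, h⟩
      rw [ne_eq, L.weierstrassP_eq_iff h0 hw, not_or] at h
      simpa [offLattice, T, ← sub_eq_add_neg] using ⟨h0, h.1, h.2⟩
  have hXY {v : ℂ} (hv : v ∈ L.offLattice T) :
      HasDerivAt X (Y v) v ∧ HasDerivAt Y (6 * X v ^ 2 - L.g₂ / 2) v :=
    hasDerivAt_chord (L.hasDerivAt_weierstrassP (hU.mp hv).1)
      (L.hasDerivAt_derivWeierstrassP (hU.mp hv).1) (L.derivWeierstrassP_sq v (hU.mp hv).1)
      hwe (hU.mp hv).2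
  have hXan : AnalyticOnNhd ℂ X (L.offLattice T) :=
    DifferentiableOn.analyticOnNhd
      (fun v hv => (hXY hv).1.differentiableAt.differentiableWithinAt) (L.isOpen_offLattice T)
  obtain ⟨v₀, hv₀⟩ := (L.isConnected_offLattice T).nonempty
  -- The sum at the base point `v₀` lies on the curve, so it is parametrized by some `c = v₀ + d`;
  -- this fixes the translation `d`.
  obtain ⟨c, hc, hcX, hcY⟩ := L.exists_weierstrassP_derivWeierstrassP_eq
    (chord_equation (L.derivWeierstrassP_sq v₀ (hU.mp hv₀).1) hwe (hU.mp hv₀).2)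
  obtain ⟨d, rfl⟩ : ∃ d, c = v₀ + d := ⟨c - v₀, by ring⟩
  have hloc := L.eventuallyEq_weierstrassP_add hc (hXan v₀ hv₀) hcX.symm
    (by rw [(hXY hv₀).1.deriv, hcY]) (by
      filter_upwards [(L.isOpen_offLattice T).mem_nhds hv₀] with v hv
      have : deriv X =ᶠ[𝓝 v] Y := by
        filter_upwards [(L.isOpen_offLattice T).mem_nhds hv] with u hu using (hXY hu).1.deriv
      rw [this.deriv_eq, (hXY hv).2.deriv])
  set T' := insert d T
  have hTT {v : ℂ} : v ∈ L.offLattice T' ↔ v + d ∉ L.lattice ∧ v ∈ L.offLattice T := by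
    simp [offLattice, T', T]
  have hXeq : Set.EqOn X (fun v => L.weierstrassP (v + d)) (L.offLattice T') := by
    refine AnalyticOnNhd.eqOn_of_preconnected_of_eventuallyEq (𝕜 := ℂ) (z₀ := v₀) ?_ ?_
      (L.isConnected_offLattice T').isPreconnected (hTT.mpr ⟨hc, hv₀⟩) hloc
    · intro v hv
      exact hXan v (hTT.mp hv).2
    · intro v hv
      exact (L.analyticAt_weierstrassP (hTT.mp hv).1).fun_comp (f := fun v => v + d)
        (by fun_prop)
  have hYeq : Set.EqOn Y (fun v => L.derivWeierstrassP (v + d)) (L.offLattice T') := by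
    intro v hv
    have : X =ᶠ[𝓝 v] fun v => L.weierstrassP (v + d) :=
      hXeq.eventuallyEq_of_mem ((L.isOpen_offLattice T').mem_nhds hv)
    have := this.deriv_eq
    rwa [(hXY (hTT.mp hv).2).1.deriv, deriv_comp_add_const, deriv_weierstrassP] at this
  -- As `v → 0` the point at `v` goes to infinity, so the sum tends to the point at `w`; this
  -- identifies `d` with `w` modulo `L`.
  have hlim := tendsto_chord (b := L.derivWeierstrassP w) (a := L.weierstrassP w) (by
    filter_upwards [L.compl_lattice_mem_nhdsNE 0] with v hv using L.derivWeierstrassP_sq v hv)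
    (L.tendsto_weierstrassP_cobounded (zero_mem _))
  have hlimX : Tendsto (fun v => L.weierstrassP (v + d)) (𝓝[≠] 0) (𝓝 (L.weierstrassP w)) :=
    hlim.1.congr' (hXeq.eventuallyEq_of_mem (L.offLattice_mem_nhdsNE T' 0))
  have hlimY : Tendsto (fun v => L.derivWeierstrassP (v + d)) (𝓝[≠] 0)
      (𝓝 (L.derivWeierstrassP w)) :=
    hlim.2.congr' (hYeq.eventuallyEq_of_mem (L.offLattice_mem_nhdsNE T' 0))
  have hd : d ∉ L.lattice := by
    intro hd
    have : (fun v => L.weierstrassP (v + d)) = L.weierstrassP :=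
      funext fun v => L.weierstrassP_add_coe v ⟨d, hd⟩
    rw [this] at hlimX
    exact not_tendsto_nhds_of_tendsto_atTop (tendsto_norm_atTop_iff_cobounded.mpr
      (L.tendsto_weierstrassP_cobounded (zero_mem _))) _ hlimX.norm
  have hshift : Tendsto (fun v : ℂ => v + d) (𝓝[≠] 0) (𝓝 d) := by
    simpa using ((continuous_add_const d).tendsto 0).mono_left nhdsWithin_le_nhds
  have hdw : d - w ∈ L.lattice := L.sub_mem_lattice_of_weierstrassP_eq hd hw
    (tendsto_nhds_unique
      ((L.analyticAt_weierstrassP hd).continuousAt.tendsto.comp hshift) hlimX)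
    (tendsto_nhds_unique
      ((L.analyticAt_derivWeierstrassP hd).continuousAt.tendsto.comp hshift) hlimY)
  have hadd (v : ℂ) : v + d = v + w + ((⟨d - w, hdw⟩ : L.lattice) : ℂ) := by
    simp
  have hzT : z ∈ L.offLattice T' := by
    refine hTT.mpr ⟨?_, hU.mpr ⟨hz, hne⟩⟩
    rw [show z + d = z + w + (d - w) by ring,
      Submodule.add_mem_iff_left _ hdw]
    exact hU.mpr ⟨hz, hne⟩ w (by simp [T])
  exact ⟨(L.weierstrassP_add_coe _ ⟨d - w, hdw⟩).symm.trans
      ((congrArg _ (hadd z).symm).trans (hXeq hzT).symm),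
    (L.derivWeierstrassP_add_coe _ ⟨d - w, hdw⟩).symm.trans
      ((congrArg _ (hadd z).symm).trans (hYeq hzT).symm)⟩

end PeriodPair

/-! ### Smoothness of the projective cubic -/

/-- At a common zero of the partials with `Z ≠ 0` one gets `Y = 0`, `12X² = aZ²` and `2aX = -3bZ`,
whence `a³ = 27b²`; if `Z = 0`, all coordinates vanish. -/
theorem isNonsingularCubic_of_ne {a b : ℂ} (h : a ^ 3 ≠ 27 * b ^ 2) : IsNonsingularCubic a b := by
  intro v hv _
  by_contra! hd
  have h0 := hd 0
  have h1 := hd 1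
  have h2 := hd 2
  simp only [cubicForm, map_add, map_sub, Derivation.leibniz, Derivation.leibniz_pow,
    MvPolynomial.pderiv_X, MvPolynomial.pderiv_C, Pi.single_apply, map_mul, map_pow,
    MvPolynomial.eval_X, MvPolynomial.eval_C, smul_eq_mul, nsmul_eq_mul] at h0 h1 h2
  simp at h0 h1 h2
  have hz : v 2 = 0 := by
    by_contra hz
    have hy : v 1 = 0 := by simpa [hz] using h1
    have h3 : 2 * a * v 0 = -3 * b * v 2 := by
      apply mul_right_cancel₀ hz
      linear_combination h2 - v 1 * hy
    apply h
    apply mul_right_cancel₀ (pow_ne_zero 2 hz)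
    linear_combination a ^ 2 * h0 + (6 * a * v 0 - 9 * b * v 2) * h3
  have hx : v 0 = 0 := by simpa [hz] using h0
  have hy : v 1 = 0 := by simpa [hz] using h2
  exact hv (by ext i; fin_cases i <;> assumption)

/-! ### The group isomorphism from the torus -/

namespace PeriodPair

variable (L : PeriodPair)

theorem isNonsingularCubic : IsNonsingularCubic (60 * L.G 4) (140 * L.G 6) :=
  isNonsingularCubic_of_ne L.g₂_cube_ne

/-- The elliptic curve `y² = 4x³ - g₂x - g₃` attached to a lattice. -/
noncomputable def ellipticCubic : EllipticCubic := ⟨60 * L.G 4, 140 * L.G 6, L.isNonsingularCubic⟩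

theorem ellipticCubic_equation {z : ℂ} (hz : z ∉ L.lattice) :
    L.derivWeierstrassP z ^ 2 = 4 * L.weierstrassP z ^ 3
      - L.ellipticCubic.a * L.weierstrassP z - L.ellipticCubic.b :=
  L.derivWeierstrassP_sq z hz

open Classical in
/-- The parametrization `z ↦ (℘ z, ℘' z)` of the elliptic curve attached to a lattice. -/
noncomputable def toPoint (z : ℂ) : L.ellipticCubic.Point :=
  if hz : z ∈ L.lattice then .O
  else .affine (L.weierstrassP z) (L.derivWeierstrassP z) (L.ellipticCubic_equation hz)

theorem toPoint_of_mem {z : ℂ} (hz : z ∈ L.lattice) : L.toPoint z = 0 := dif_pos hz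

theorem toPoint_of_notMem {z : ℂ} (hz : z ∉ L.lattice) : L.toPoint z =
    .affine (L.weierstrassP z) (L.derivWeierstrassP z) (L.ellipticCubic_equation hz) :=
  dif_neg hz

theorem toPoint_eq_zero_iff {z : ℂ} : L.toPoint z = 0 ↔ z ∈ L.lattice := by
  refine ⟨fun h => ?_, L.toPoint_of_mem⟩
  by_contra hz
  rw [L.toPoint_of_notMem hz] at h
  cases h

theorem toPoint_add_of_mem (z : ℂ) {l : ℂ} (hl : l ∈ L.lattice) :
    L.toPoint (z + l) = L.toPoint z := by
  have hiff : z + l ∈ L.lattice ↔ z ∈ L.lattice := Submodule.add_mem_iff_left _ hl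
  by_cases hz : z ∈ L.lattice
  · rw [L.toPoint_of_mem hz, L.toPoint_of_mem (hiff.mpr hz)]
  · rw [L.toPoint_of_notMem hz, L.toPoint_of_notMem (hiff.not.mpr hz),
      EllipticCubic.Point.affine.injEq]
    exact ⟨L.weierstrassP_add_coe z ⟨l, hl⟩, L.derivWeierstrassP_add_coe z ⟨l, hl⟩⟩

theorem toPoint_neg (z : ℂ) : L.toPoint (-z) = -L.toPoint z := by
  by_cases hz : z ∈ L.lattice
  · rw [L.toPoint_of_mem hz, L.toPoint_of_mem (neg_mem hz), neg_zero]
  · rw [L.toPoint_of_notMem hz, L.toPoint_of_notMem (by simpa)]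
    change _ = EllipticCubic.Point.affine _ _ _
    simp

theorem toPoint_surjective : Function.Surjective L.toPoint := by
  rintro (_ | ⟨x, y, h⟩)
  · exact ⟨0, L.toPoint_of_mem (zero_mem _)⟩
  · obtain ⟨z, hz, rfl, rfl⟩ := L.exists_weierstrassP_derivWeierstrassP_eq h
    exact ⟨z, L.toPoint_of_notMem hz⟩

/-- Away from lattice points, `z ≢ w` leaves a vertical chord only for `z ≡ -w`, settled by
`toPoint_neg`; otherwise `weierstrassP_add` applies. -/
theorem toPoint_add_of_sub_notMem {z w : ℂ} (h : z - w ∉ L.lattice) :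
    L.toPoint (z + w) = L.toPoint z + L.toPoint w := by
  by_cases hw : w ∈ L.lattice
  · rw [L.toPoint_add_of_mem z hw, L.toPoint_of_mem hw, add_zero]
  by_cases hz : z ∈ L.lattice
  · rw [add_comm z, L.toPoint_add_of_mem w hz, L.toPoint_of_mem hz, zero_add]
  by_cases hs : z + w ∈ L.lattice
  · have : z = -w + (z + w) := by ring
    rw [L.toPoint_of_mem hs, this, L.toPoint_add_of_mem _ hs, L.toPoint_neg, neg_add_cancel]
  have hne : L.weierstrassP z ≠ L.weierstrassP w := by
    rw [ne_eq, L.weierstrassP_eq_iff hz hw]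
    tauto
  rw [L.toPoint_of_notMem hz, L.toPoint_of_notMem hw, L.toPoint_of_notMem hs]
  change _ = EllipticCubic.add _ _
  simp only [EllipticCubic.add, EllipticCubic.slope, hne, false_and, dite_false, if_false]
  rw [EllipticCubic.Point.affine.injEq]
  exact L.weierstrassP_add hz hw hne

theorem toPoint_add (z w : ℂ) : L.toPoint (z + w) = L.toPoint z + L.toPoint w := by
  by_cases h : z - w ∈ L.lattice
  swap
  · exact L.toPoint_add_of_sub_notMem h
  have hd : L.toPoint (z + z) = L.toPoint z + L.toPoint z := by
    -- Split `z + z = (z + (z - t)) + t` with `t` generic: `2t - z`, `2t` and `2t - 2z` avoid `L`,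
    -- so every addition used is between incongruent arguments.
    obtain ⟨s, hs⟩ := (L.isConnected_offLattice {0, z, -z}).nonempty
    obtain ⟨t, rfl⟩ : ∃ t, s = 2 * t - z := ⟨(s + z) / 2, by ring⟩
    have h₁ : (z - t) - t ∉ L.lattice := by
      rw [← neg_mem_iff, show -(z - t - t) = 2 * t - z + 0 by ring]
      exact hs 0 (by simp)
    have h₂ : z - (z - t) ∉ L.lattice := by
      intro ht
      refine hs z (by simp) ?_
      rw [show 2 * t - z + z = (z - (z - t)) + (z - (z - t)) by ring]
      exact add_mem ht ht
    have h₃ : (z + (z - t)) - t ∉ L.lattice := by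
      rw [← neg_mem_iff, show -(z + (z - t) - t) = 2 * t - z + -z by ring]
      exact hs (-z) (by simp)
    have e₁ := L.toPoint_add_of_sub_notMem h₁
    have e₃ := L.toPoint_add_of_sub_notMem h₃
    rw [sub_add_cancel] at e₁
    rw [show z + (z - t) + t = z + z by ring] at e₃
    rw [e₃, L.toPoint_add_of_sub_notMem h₂, add_assoc, ← e₁]
  have hw : L.toPoint w = L.toPoint z := by
    rw [← L.toPoint_add_of_mem w h, add_sub_cancel]
  rw [hw, ← hd, ← L.toPoint_add_of_mem (z + w) h]
  congr 1
  ring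

/-- The parametrization `z ↦ (℘ z, ℘' z)` as an isomorphism from the complex torus. -/
noncomputable def torusEquivPoint : (ℂ ⧸ L.lattice) ≃+ L.ellipticCubic.Point :=
  AddEquiv.ofBijective
    (L.lattice.liftQ (AddMonoidHom.mk' L.toPoint L.toPoint_add).toIntLinearMap
      fun _ hz => L.toPoint_of_mem hz)
    ⟨LinearMap.ker_eq_bot.mp (Submodule.ker_liftQ_eq_bot _ _ _
        fun _ hz => L.toPoint_eq_zero_iff.mp hz),
      fun P => by
        obtain ⟨z, hz⟩ := L.toPoint_surjective P
        exact ⟨Submodule.Quotient.mk z, hz⟩⟩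

theorem torusEquivPoint_mk (z : ℂ) :
    L.torusEquivPoint (Submodule.Quotient.mk z) = L.toPoint z := rfl

end PeriodPair

theorem mainTheorem2 (L : PeriodPair) :
    (⟨4, 0, -(60 * L.G 4), -(140 * L.G 6)⟩ : Cubic ℂ).discr ≠ 0 ∧
    ∃ hE : IsNonsingularCubic (60 * L.G 4) (140 * L.G 6),
      ∃ φ : (ℂ ⧸ L.lattice) ≃+ EllipticCubic.Point ⟨60 * L.G 4, 140 * L.G 6, hE⟩,
        φ 0 = EllipticCubic.Point.O ∧
        ∀ z : ℂ, z ∉ L.lattice →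
          ∃ h : L.derivWeierstrassP z ^ 2 =
              4 * L.weierstrassP z ^ 3 - 60 * L.G 4 * L.weierstrassP z - 140 * L.G 6,
            φ (Submodule.Quotient.mk z) =
              EllipticCubic.Point.affine (L.weierstrassP z) (L.derivWeierstrassP z) h := by
  refine ⟨fun h => L.g₂_cube_ne ?_, L.isNonsingularCubic, L.torusEquivPoint,
    map_zero L.torusEquivPoint, fun z hz => ⟨L.derivWeierstrassP_sq z hz, ?_⟩⟩
  · simp only [Cubic.discr] at h
    rw [PeriodPair.g₂, PeriodPair.g₃]
    -- The discriminant of `4x³ - g₂x - g₃` is `16(g₂³ - 27g₃²)`.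
    linear_combination h / 16
  · exact (L.torusEquivPoint_mk z).trans (L.toPoint_of_notMem hz)
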